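/- For complex numbers $a, q$ with $|q|<1$ put $(a;q)_n=\prod_{j=1}^{n}(1-aq^{j-1})$ for integers $n\ge 0$, $(a;q)_\infty=\lim_{n\to\infty}(a;q)_n$, and $(a_1,a_2,a_3,a_4;q)_\infty=\prod_{i=1}^{4}(a_i;q)_\infty$. **Theorem.** For every complex number $q$ with $|q|<1$ the following three double series converge absolutely, and $$\sum_{m,n\ge 0}\frac{(-1)^n q^{2\binom{m+1}{2}+2\binom{n+1}{2}+2mn-m-n}}{(q;q)_m(q^2;q^2)_n}=\frac{1}{(q^2,q^4,q^{10},q^{12};q^{14})_\infty},$$ $$\sum_{m,n\ge 0}\frac{(-1)^n q^{2\binom{m+1}{2}+2\binom{n+1}{2}+2mn+n}}{(q;q)_m(q^2;q^2)_n}=\frac{1}{(q^2,q^6,q^8,q^{12};q^{14})_\infty},$$ $$\sum_{m,n\ge 0}\frac{(-1)^n q^{2\binom{m+1}{2}+2\binom{n+1}{2}+2mn+m+n}}{(q;q)_m(q^2;q^2)_n}=\frac{1}{(q^4,q^6,q^8,q^{10};q^{14})_\infty}.$$ -/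

import Mathlib

open Filter Topology

/-- The finite `q`-Pochhammer symbol `(a; q)_n = ∏_{j=1}^n (1 - a q^{j-1})`. -/
noncomputable def qPoch (a q : ℂ) (n : ℕ) : ℂ :=
  ∏ j ∈ Finset.Icc 1 n, (1 - a * q ^ (j - 1))

/-- The infinite `q`-Pochhammer symbol `(a; q)_∞ = lim_{n → ∞} (a; q)_n`.
For `‖q‖ < 1` the limit exists, see `tendsto_qPoch`. -/
noncomputable def qPochInf (a q : ℂ) : ℂ :=
  limUnder atTop (fun n : ℕ => qPoch a q n)

/-- The usual abbreviation `(a, b, c, d; q)_∞ = (a; q)_∞ (b; q)_∞ (c; q)_∞ (d; q)_∞`. -/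
noncomputable def qPochInf₄ (a b c d q : ℂ) : ℂ :=
  qPochInf a q * qPochInf b q * qPochInf c q * qPochInf d q

/-- The general term
`(-1)^n q^{2 C(m+1,2) + 2 C(n+1,2) + 2mn + c m + d n} / ((q; q)_m (q^2; q^2)_n)`.
The exponent is an integer, as `c` and `d` may be negative. -/
noncomputable def altTerm (c d : ℤ) (q : ℂ) (m n : ℕ) : ℂ :=
  (-1) ^ n *
    q ^ (2 * ((m + 1).choose 2 : ℤ) + 2 * ((n + 1).choose 2 : ℤ) + 2 * (m : ℤ) * (n : ℤ)
          + c * (m : ℤ) + d * (n : ℤ)) /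
    (qPoch q q m * qPoch (q ^ 2) (q ^ 2) n)

theorem qPoch_eq_prod_range (a q : ℂ) (n : ℕ) :
    qPoch a q n = ∏ j ∈ Finset.range n, (1 + -(a * q ^ j)) := by
  unfold qPoch
  rw [← Finset.Ico_add_one_right_eq_Icc, Finset.prod_Ico_eq_prod_range]
  refine Finset.prod_congr (by simp) fun j _ => ?_
  rw [Nat.add_sub_cancel_left, sub_eq_add_neg]

theorem summable_norm_qPoch {q : ℂ} (hq : ‖q‖ < 1) (a : ℂ) :
    Summable (fun j : ℕ => ‖-(a * q ^ j)‖) := by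
  simp only [norm_neg, norm_mul, norm_pow]
  exact (summable_geometric_of_lt_one (norm_nonneg q) hq).mul_left _

theorem qPochInf_eq_tprod {q : ℂ} (hq : ‖q‖ < 1) (a : ℂ) :
    qPochInf a q = ∏' j : ℕ, (1 + -(a * q ^ j)) := by
  refine Tendsto.limUnder_eq ?_
  simp only [qPoch_eq_prod_range]
  exact (multipliable_one_add_of_summable (summable_norm_qPoch hq a)).tendsto_prod_tprod_nat

/-- The limit that defines `(a; q)_∞` exists when `‖q‖ < 1`. -/
theorem tendsto_qPoch {q : ℂ} (hq : ‖q‖ < 1) (a : ℂ) :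
    Tendsto (fun n : ℕ => qPoch a q n) atTop (𝓝 (qPochInf a q)) := by
  rw [qPochInf_eq_tprod hq]
  simp only [qPoch_eq_prod_range]
  exact (multipliable_one_add_of_summable (summable_norm_qPoch hq a)).tendsto_prod_tprod_nat

/-- `(a; q)_∞` does not vanish when `‖a‖ < 1` and `‖q‖ < 1`. -/
theorem qPochInf_ne_zero {a q : ℂ} (ha : ‖a‖ < 1) (hq : ‖q‖ < 1) : qPochInf a q ≠ 0 := by
  rw [qPochInf_eq_tprod hq]
  refine tprod_one_add_ne_zero_of_summable (fun j h => ?_) (summable_norm_qPoch hq a)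
  have h1 : a * q ^ j = 1 := by linear_combination -h
  have h2 : ‖a * q ^ j‖ < 1 := by
    rw [norm_mul, norm_pow]
    exact (mul_le_of_le_one_right (norm_nonneg a)
      (pow_le_one₀ (norm_nonneg q) hq.le)).trans_lt ha
  rw [h1, norm_one] at h2
  exact lt_irrefl _ h2

/-!
The exponents depend on `m` and `n` essentially through `N = m + n`: the quadratic part is `N² + N`.
Hence each double series has the form `∑ q^{N² + kN} c_N`, where `c_N` are the coefficients of the
product of two of Euler's series, with value `1 / ((X; q)_∞ (-yX; q²)_∞)` for `y = 1` or `y = q`.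
Writing `z = q / y`, so that `{y, z} = {1, q}`, the factors of this product regroup to
`1 / ((y²X²; q⁴)_∞ (zX; q²)_∞)`; as identities of formal power series this is
`eulerSeries_mul_eulerSeries`, proved from a functional equation under `X ↦ q²X`. Expanding the
new product gives another double series, whose sum over the second index is Euler's series for
`(-q^{2j+2}; q²)_∞` (`tsum_eulerTerm`). What remains (`hasSum_double_series`) is the left-hand side
of one of the three Rogers–Selberg identities modulo `7`, with `q²` in place of `q`.

The Rogers–Selberg identities are proved by Bailey's method. With `Q = q⁴`, the finite sums
`∑_r (-1)^r q^{3r² + cr} / ((Q; Q)_{a-r} (Q; Q)_{b+r})`, called `bilat`, have closed forms for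
`b = a` and `b = a + 1`; these follow by induction from the two `q`-Pascal rules and the symmetries
of the sum (`bilat_one_self`, `bilat_one_succ`, `bilat_neg_one_succ`). Summing them against
`q^{4n² + 4en}` and interchanging the summations, the inner sum is Cauchy's Durfee rectangle series
(`tsum_durfeeTerm`), and a theta series `∑_r (-1)^r q^{7r² + cr}` remains (`hasSum_bailey`). The
Jacobi triple product (`altTheta_eq_qPochInf`), obtained as the limit of another closed form of
`bilat`, turns it into a product, which cancels three of the seven residue classes in
`(q²; q²)_∞ = ∏_{i=1}^{7} (q^{2i}; q^{14})_∞`.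

Bilateral sums involve negative powers of `q`, so `q = 0` is treated separately in
`hasSum_rogersSelberg_zero`.
-/

/-! ### Finite and infinite `q`-Pochhammer symbols -/

theorem qPoch_zero (a q : ℂ) : qPoch a q 0 = 1 := by simp [qPoch]

theorem qPoch_succ (a q : ℂ) (n : ℕ) : qPoch a q (n + 1) = qPoch a q n * (1 - a * q ^ n) := by
  simp [qPoch_eq_prod_range, Finset.prod_range_succ, sub_eq_add_neg]

theorem qPoch_self_succ (q : ℂ) (n : ℕ) : qPoch q q (n + 1) = qPoch q q n * (1 - q ^ (n + 1)) := by
  rw [qPoch_succ, pow_succ']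

theorem norm_pow_lt_one {q : ℂ} (hq : ‖q‖ < 1) {n : ℕ} (hn : n ≠ 0) : ‖q ^ n‖ < 1 := by
  rw [norm_pow]
  exact pow_lt_one₀ (norm_nonneg q) hq hn

theorem one_sub_ne_zero_of_norm_lt_one {x : ℂ} (hx : ‖x‖ < 1) : 1 - x ≠ 0 := by
  intro h
  rw [← sub_eq_zero.1 h, norm_one] at hx
  exact lt_irrefl _ hx

theorem one_add_ne_zero_of_norm_lt_one {x : ℂ} (hx : ‖x‖ < 1) : 1 + x ≠ 0 := by
  have := one_sub_ne_zero_of_norm_lt_one (x := -x) (by rwa [norm_neg])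
  rwa [sub_neg_eq_add] at this

theorem qPoch_ne_zero {a q : ℂ} (ha : ‖a‖ < 1) (hq : ‖q‖ < 1) (n : ℕ) : qPoch a q n ≠ 0 := by
  induction n with
  | zero => simp [qPoch_zero]
  | succ n ih =>
    rw [qPoch_succ]
    refine mul_ne_zero ih (one_sub_ne_zero_of_norm_lt_one ?_)
    rw [norm_mul, norm_pow]
    exact (mul_le_of_le_one_right (norm_nonneg a) (pow_le_one₀ (norm_nonneg q) hq.le)).trans_lt ha

theorem tendsto_inv_qPoch {a q : ℂ} (ha : ‖a‖ < 1) (hq : ‖q‖ < 1) :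
    Tendsto (fun n : ℕ => (qPoch a q n)⁻¹) atTop (𝓝 (qPochInf a q)⁻¹) :=
  (tendsto_qPoch hq a).inv₀ (qPochInf_ne_zero ha hq)

theorem exists_norm_inv_qPoch_le {a q : ℂ} (ha : ‖a‖ < 1) (hq : ‖q‖ < 1) :
    ∃ C : ℝ, 0 ≤ C ∧ ∀ n : ℕ, ‖(qPoch a q n)⁻¹‖ ≤ C := by
  obtain ⟨C, hC⟩ := (Metric.isBounded_range_of_tendsto _ (tendsto_inv_qPoch ha hq)).exists_norm_le
  have h (n : ℕ) : ‖(qPoch a q n)⁻¹‖ ≤ C := hC _ ⟨n, rfl⟩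
  exact ⟨C, (norm_nonneg _).trans (h 0), h⟩

theorem qPoch_neg_mul_qPoch (q : ℂ) (n : ℕ) :
    qPoch (-q) q n * qPoch q q n = qPoch (q ^ 2) (q ^ 2) n := by
  induction n with
  | zero => simp [qPoch_zero]
  | succ n ih =>
    simp only [qPoch_succ, ← ih]
    ring

theorem qPochInf_neg_mul_qPochInf {q : ℂ} (hq : ‖q‖ < 1) :
    qPochInf (-q) q * qPochInf q q = qPochInf (q ^ 2) (q ^ 2) := by
  have h := (tendsto_qPoch hq (-q)).mul (tendsto_qPoch hq q)
  simp only [qPoch_neg_mul_qPoch] at h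
  exact tendsto_nhds_unique h (tendsto_qPoch (norm_pow_lt_one hq two_ne_zero) _)

theorem qPoch_self_seven_mul (q : ℂ) (n : ℕ) :
    qPoch q q (7 * n) = qPoch q (q ^ 7) n * qPoch (q ^ 2) (q ^ 7) n * qPoch (q ^ 3) (q ^ 7) n *
      qPoch (q ^ 4) (q ^ 7) n * qPoch (q ^ 5) (q ^ 7) n * qPoch (q ^ 6) (q ^ 7) n *
      qPoch (q ^ 7) (q ^ 7) n := by
  induction n with
  | zero => simp [qPoch_zero]
  | succ n ih =>
    rw [show 7 * (n + 1) = 7 * n + 1 + 1 + 1 + 1 + 1 + 1 + 1 by ring]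
    simp only [qPoch_succ, ih]
    ring

/-- Sorting the factors of `(q; q)_∞` by the residue of the exponent modulo `7`. -/
theorem qPochInf_self_eq_prod_seven {q : ℂ} (hq : ‖q‖ < 1) :
    qPochInf q q = qPochInf q (q ^ 7) * qPochInf (q ^ 2) (q ^ 7) * qPochInf (q ^ 3) (q ^ 7) *
      qPochInf (q ^ 4) (q ^ 7) * qPochInf (q ^ 5) (q ^ 7) * qPochInf (q ^ 6) (q ^ 7) *
      qPochInf (q ^ 7) (q ^ 7) := by
  have h7 : ‖q ^ 7‖ < 1 := norm_pow_lt_one hq (by norm_num)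
  have h := (tendsto_qPoch hq q).comp
    (tendsto_id.const_mul_atTop' (show (0 : ℕ) < 7 by norm_num))
  refine tendsto_nhds_unique h ?_
  simp only [Function.comp_def, id, qPoch_self_seven_mul]
  exact ((((((tendsto_qPoch h7 _).mul (tendsto_qPoch h7 _)).mul (tendsto_qPoch h7 _)).mul
    (tendsto_qPoch h7 _)).mul (tendsto_qPoch h7 _)).mul (tendsto_qPoch h7 _)).mul
    (tendsto_qPoch h7 _)

/-- The reciprocal `1 / (q; q)_k`, extended by `0` to negative `k`. -/
noncomputable def invPoch (q : ℂ) (k : ℤ) : ℂ := if 0 ≤ k then (qPoch q q k.toNat)⁻¹ else 0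

theorem invPoch_natCast (q : ℂ) (n : ℕ) : invPoch q n = (qPoch q q n)⁻¹ := by simp [invPoch]

theorem invPoch_zero (q : ℂ) : invPoch q 0 = 1 := by simp [invPoch, qPoch_zero]

theorem invPoch_of_neg (q : ℂ) {k : ℤ} (hk : k < 0) : invPoch q k = 0 := by
  simp [invPoch, not_le.2 hk]

/-- The convention at negative indices makes this recurrence hold for all integers `k`. -/
theorem one_sub_zpow_mul_invPoch {q : ℂ} (hq : ‖q‖ < 1) (k : ℤ) :
    (1 - q ^ k) * invPoch q k = invPoch q (k - 1) := by
  rcases lt_trichotomy k 0 with hk | rfl | hk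
  · rw [invPoch_of_neg q hk, invPoch_of_neg q (by lia), mul_zero]
  · rw [invPoch_of_neg q (show (0 : ℤ) - 1 < 0 by norm_num), zpow_zero, sub_self, zero_mul]
  · obtain ⟨n, rfl⟩ : ∃ n : ℕ, k = ((n + 1 : ℕ) : ℤ) := ⟨(k - 1).toNat, by lia⟩
    rw [show ((n + 1 : ℕ) : ℤ) - 1 = n by push_cast; ring, invPoch_natCast, invPoch_natCast,
      qPoch_self_succ, zpow_natCast]
    have h1 := one_sub_ne_zero_of_norm_lt_one (norm_pow_lt_one hq n.succ_ne_zero)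
    have h2 := qPoch_ne_zero hq hq n
    field_simp

theorem exists_norm_invPoch_le {q : ℂ} (hq : ‖q‖ < 1) :
    ∃ C : ℝ, 0 ≤ C ∧ ∀ k : ℤ, ‖invPoch q k‖ ≤ C := by
  obtain ⟨C, hC0, hC⟩ := exists_norm_inv_qPoch_le hq hq
  refine ⟨C, hC0, fun k => ?_⟩
  unfold invPoch
  split_ifs
  · exact hC _
  · simpa using hC0

theorem tendsto_invPoch {q : ℂ} (hq : ‖q‖ < 1) :
    Tendsto (invPoch q) atTop (𝓝 (qPochInf q q)⁻¹) := by
  have h := (tendsto_inv_qPoch hq hq).comp (tendsto_atTop.2 fun b : ℕ =>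
    (eventually_ge_atTop (b : ℤ)).mono fun k hk => show b ≤ k.toNat by lia)
  refine h.congr' ?_
  filter_upwards [eventually_ge_atTop 0] with k hk
  simp [invPoch, hk]

theorem summable_pow_natAbs {x : ℝ} (hx0 : 0 ≤ x) (hx : x < 1) :
    Summable (fun m : ℤ => x ^ m.natAbs) := by
  refine Summable.of_nat_of_neg ?_ ?_ <;>
  simpa using summable_geometric_of_lt_one hx0 hx

/-- The terms of a partial theta series are absolutely summable over `ℤ`. -/
theorem summable_zpow_quadratic {x : ℝ} (hx0 : 0 < x) (hx : x < 1) {t : ℤ} (ht : 0 < t) (c : ℤ) :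
    Summable (fun m : ℤ => x ^ (t * m ^ 2 + c * m)) := by
  refine Summable.of_nonneg_of_le (fun m => (zpow_pos hx0 _).le) (fun m => ?_)
    ((summable_pow_natAbs hx0.le hx).mul_left (x ^ (-(|c| + 1) ^ 2)))
  rw [← zpow_natCast, ← zpow_add₀ hx0.ne']
  refine zpow_le_zpow_right_of_le_one₀ hx0 hx.le ?_
  rw [Int.natCast_natAbs]
  have h1 : -(|c| * |m|) ≤ c * m := by rw [← abs_mul]; exact neg_abs_le _
  have h2 : |m| ^ 2 ≤ t * m ^ 2 := by rw [sq_abs]; nlinarith [sq_nonneg m]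
  nlinarith [sq_nonneg (|m| - (|c| + 1)), abs_nonneg m, abs_nonneg c,
    mul_nonneg (abs_nonneg m) (abs_nonneg c)]

/-! ### Bilateral sums with closed forms -/

theorem pow_zpow_eq (q : ℂ) (d : ℕ) (k : ℤ) : (q ^ d) ^ k = q ^ ((d : ℤ) * k) := by
  rw [zpow_mul, zpow_natCast]

/-- The summand of `bilat`. -/
noncomputable def bilatTerm (q : ℂ) (d : ℕ) (t c a b r : ℤ) : ℂ :=
  (-1) ^ r * q ^ (t * r ^ 2 + c * r) * (invPoch (q ^ d) (a - r) * invPoch (q ^ d) (b + r))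

/-- The sum `∑_{r ∈ ℤ} (-1)^r q^{t r² + c r} / ((Q; Q)_{a - r} (Q; Q)_{b + r})` with `Q = q ^ d`.
Only the terms with `-b ≤ r ≤ a` are nonzero. -/
noncomputable def bilat (q : ℂ) (d : ℕ) (t c a b : ℤ) : ℂ := ∑' r : ℤ, bilatTerm q d t c a b r

section bilat

variable {q : ℂ} {d : ℕ}

theorem bilatTerm_eq_zero {t c a b r : ℤ} (hr : r ∉ Finset.Icc (-b) a) :
    bilatTerm q d t c a b r = 0 := by
  rw [Finset.mem_Icc, not_and_or, not_le, not_le] at hr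
  unfold bilatTerm
  rcases hr with hr | hr
  · rw [invPoch_of_neg _ (show b + r < 0 by lia), mul_zero, mul_zero]
  · rw [invPoch_of_neg _ (show a - r < 0 by lia), zero_mul, mul_zero]

theorem summable_bilatTerm (t c a b : ℤ) : Summable (bilatTerm q d t c a b) :=
  summable_of_ne_finset_zero (s := Finset.Icc (-b) a) fun _ hr => bilatTerm_eq_zero hr

theorem bilat_zero_zero (t c : ℤ) : bilat q d t c 0 0 = 1 := by
  unfold bilat
  rw [tsum_eq_single 0]
  · simp [bilatTerm, invPoch_zero]
  · intro r hr
    exact bilatTerm_eq_zero (by simpa [← le_antisymm_iff, eq_comm] using hr)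

theorem bilat_neg_left {t c a b : ℤ} (h : a + b < 0) : bilat q d t c a b = 0 := by
  unfold bilat
  rw [← tsum_zero (α := ℂ) (β := ℤ)]
  refine tsum_congr fun r => bilatTerm_eq_zero ?_
  rw [Finset.mem_Icc]
  lia

theorem bilat_swap (t c a b : ℤ) : bilat q d t c a b = bilat q d t (-c) b a := by
  unfold bilat
  rw [← (Equiv.neg ℤ).tsum_eq]
  refine tsum_congr fun r => ?_
  simp only [bilatTerm, Equiv.neg_apply, zpow_neg, neg_sq, sub_neg_eq_add, ← sub_eq_add_neg,
    neg_mul, mul_neg, ← inv_zpow, inv_neg, inv_one]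
  ring

theorem bilat_shift (hq0 : q ≠ 0) (t c a b : ℤ) :
    bilat q d t c a b = -q ^ (t + c) * bilat q d t (c + 2 * t) (a - 1) (b + 1) := by
  unfold bilat
  rw [← tsum_mul_left, ← (Equiv.addRight (1 : ℤ)).tsum_eq]
  refine tsum_congr fun r => ?_
  simp only [bilatTerm, Equiv.coe_addRight]
  rw [show t * (r + 1) ^ 2 + c * (r + 1) = (t + c) + (t * r ^ 2 + (c + 2 * t) * r) by ring,
    zpow_add₀ hq0, zpow_add_one₀ (by norm_num), show a - (r + 1) = a - 1 - r by ring,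
    show b + (r + 1) = b + 1 + r by ring]
  ring

variable (hq0 : q ≠ 0) (hQ : ‖q ^ d‖ < 1)
include hq0 hQ

/-- The first of the two `q`-Pascal rules. -/
theorem bilat_pascal_left (t c a b : ℤ) :
    (1 - q ^ (d * (a + b))) * bilat q d t c a b =
      bilat q d t c (a - 1) b + q ^ (d * a) * bilat q d t (c - d) a (b - 1) := by
  unfold bilat
  rw [← tsum_mul_left, ← tsum_mul_left, ← (summable_bilatTerm _ _ _ _).tsum_add
    ((summable_bilatTerm _ _ _ _).mul_left _)]
  refine tsum_congr fun r => ?_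
  simp only [bilatTerm]
  rw [show a - 1 - r = a - r - 1 by ring, show b - 1 + r = b + r - 1 by ring,
    ← one_sub_zpow_mul_invPoch hQ (a - r), ← one_sub_zpow_mul_invPoch hQ (b + r),
    pow_zpow_eq, pow_zpow_eq]
  have h1 : q ^ (d * (a + b)) = q ^ (d * (a - r)) * q ^ (d * (b + r)) := by
    rw [← zpow_add₀ hq0]; ring_nf
  have h2 : q ^ (d * a) * q ^ (t * r ^ 2 + (c - d) * r) =
      q ^ (t * r ^ 2 + c * r) * q ^ (d * (a - r)) := by
    rw [← zpow_add₀ hq0, ← zpow_add₀ hq0]; ring_nf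
  rw [h1]
  linear_combination (-(-1) ^ r * (invPoch (q ^ d) (a - r) *
    ((1 - q ^ (d * (b + r))) * invPoch (q ^ d) (b + r)))) * h2

/-- The second of the two `q`-Pascal rules. -/
theorem bilat_pascal_right (t c a b : ℤ) :
    (1 - q ^ (d * (a + b))) * bilat q d t c a b =
      bilat q d t c a (b - 1) + q ^ (d * b) * bilat q d t (c + d) (a - 1) b := by
  have h := bilat_pascal_left hq0 hQ t (-c) b a
  rw [bilat_swap t c a b, bilat_swap t c a, bilat_swap t _ (a - 1), add_comm a b, h, neg_add']

end bilat

section RogersSelberg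

variable {q : ℂ} (hq0 : q ≠ 0)
include hq0

/-- The substitution `r ↦ 1 - r` changes the sign of every term. -/
theorem bilat_neg_three_eq_zero (n : ℤ) : bilat q 4 3 (-3) (n + 1) n = 0 := by
  have h := bilat_shift (d := 4) hq0 3 (-3) (n + 1) n
  rw [bilat_swap 3 _ (n + 1 - 1)] at h
  norm_num at h
  linear_combination h / 2

variable (hq : ‖q‖ < 1)
include hq

theorem bilat_succ_succ (n : ℤ) :
    (1 - q ^ (4 * ((n + 1) + (n + 1)))) * bilat q 4 3 1 (n + 1) (n + 1) =
      bilat q 4 3 1 n (n + 1) := by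
  have h := bilat_pascal_left hq0 (norm_pow_lt_one hq four_ne_zero) 3 1 (n + 1) (n + 1)
  norm_num [bilat_neg_three_eq_zero hq0] at h
  exact h

theorem bilat_neg_three (n : ℕ) :
    bilat q 4 3 (-3) n n = q ^ (4 * n) * bilat q 4 3 1 n n := by
  rcases n with _ | n
  · simp [bilat_zero_zero]
  · have h := bilat_pascal_right hq0 (norm_pow_lt_one hq four_ne_zero) 3 (-3) (n + 1) (n + 1)
    have h2 := bilat_succ_succ hq0 hq n
    norm_num [bilat_neg_three_eq_zero hq0] at h
    rw [← h2] at h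
    have h3 : (1 : ℂ) - q ^ (4 * (((n : ℤ) + 1) + (n + 1))) ≠ 0 := by
      have := one_sub_ne_zero_of_norm_lt_one
        (norm_pow_lt_one hq (show 4 * ((n + 1) + (n + 1)) ≠ 0 by lia))
      exact_mod_cast this
    apply mul_left_cancel₀ h3
    push_cast
    rw [h]
    have h4 : q ^ (4 * ((n : ℤ) + 1)) = q ^ (4 * (n + 1)) := by norm_cast
    rw [h4]
    ring

theorem one_sub_mul_bilat_one_succ (n : ℤ) :
    (1 - q ^ (4 * (n + (n + 1)))) * bilat q 4 3 1 n (n + 1) =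
      (1 - q ^ (4 * n + 2)) * bilat q 4 3 1 n n := by
  have h := bilat_pascal_right hq0 (norm_pow_lt_one hq four_ne_zero) 3 1 n (n + 1)
  have h2 := bilat_shift (d := 4) hq0 3 (-1) n n
  rw [bilat_swap 3 (-1)] at h2
  norm_num at h h2
  rw [h, h2, show 4 * (n + 1) = 4 * n + 2 + 2 by ring, zpow_add₀ hq0 _ 2]
  norm_cast
  ring

/-- The sum over the `2n + 1` row with exponents `3r² + r`. -/
theorem bilat_one_succ (n : ℕ) :
    bilat q 4 3 1 n (n + 1) = bilat q 4 3 1 n n / (1 + q ^ (4 * n + 2)) := by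
  have h := one_sub_mul_bilat_one_succ hq0 hq n
  have h1 := norm_pow_lt_one hq (show 4 * n + 2 ≠ 0 by lia)
  have h2 := one_sub_ne_zero_of_norm_lt_one h1
  rw [eq_div_iff (one_add_ne_zero_of_norm_lt_one h1)]
  apply mul_left_cancel₀ h2
  have h4 : q ^ (4 * (n : ℤ) + 2) = q ^ (4 * n + 2) := by norm_cast
  have h5 : q ^ (4 * ((n : ℤ) + (n + 1))) = (q ^ (4 * n + 2)) ^ 2 := by
    rw [← pow_mul]; norm_cast; ring_nf
  rw [h4, h5] at h
  linear_combination h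

/-- The sum over the `2n + 1` row with exponents `3r² - r`. -/
theorem bilat_neg_one_succ (n : ℕ) : bilat q 4 3 (-1) n (n + 1) = bilat q 4 3 1 n n := by
  have h := bilat_pascal_right hq0 (norm_pow_lt_one hq four_ne_zero) 3 (-1) n (n + 1)
  have h2 := bilat_shift (d := 4) hq0 3 (-3) n n
  rw [bilat_neg_three hq0 hq] at h2
  norm_num at h h2
  have hs := bilat_swap (q := q) (d := 4) 3 (-1) n n
  rw [neg_neg] at hs
  rw [hs, ← neg_eq_iff_eq_neg.2 h2] at h
  have h4 : q ^ (4 * ((n : ℤ) + 1)) = q ^ (4 * n + 4) := by norm_cast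
  have h5 : q ^ (4 * ((n : ℤ) + (n + 1))) = q ^ (4 * n + 4) * q ^ (4 * n) := by
    rw [← pow_add]; norm_cast; ring_nf
  have h3 := one_sub_ne_zero_of_norm_lt_one
    (norm_pow_lt_one hq (show 4 * n + 4 + 4 * n ≠ 0 by lia))
  apply mul_left_cancel₀ h3
  rw [h4, h5] at h
  rw [pow_add q (4 * n + 4)]
  linear_combination h

/-- The Bailey pair behind the Rogers–Selberg identities: in the induction the row index passes
from `2n` to `2n + 1` by `bilat_one_succ` and on to `2n + 2` by `bilat_succ_succ`. -/
theorem bilat_one_self (n : ℕ) :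
    bilat q 4 3 1 n n = 1 / (qPoch (q ^ 4) (q ^ 4) n * qPoch (-q ^ 2) (q ^ 2) (2 * n)) := by
  induction n with
  | zero => simp [bilat_zero_zero, qPoch_zero]
  | succ n ih =>
    have h := bilat_succ_succ hq0 hq n
    rw [bilat_one_succ hq0 hq, ih] at h
    have h5 : q ^ (4 * (((n : ℤ) + 1) + (n + 1))) = (q ^ (4 * n + 4)) ^ 2 := by
      rw [← pow_mul]; norm_cast; ring_nf
    rw [h5] at h
    have h1 := norm_pow_lt_one hq (show 4 * n + 4 ≠ 0 by lia)
    have h2 := norm_pow_lt_one hq (show 4 * n + 2 ≠ 0 by lia)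
    have h3 := one_sub_ne_zero_of_norm_lt_one h1
    have h4 := one_add_ne_zero_of_norm_lt_one h1
    have h6 := one_add_ne_zero_of_norm_lt_one h2
    have n4 := norm_pow_lt_one hq four_ne_zero
    have n2 := norm_pow_lt_one hq two_ne_zero
    have h7 := qPoch_ne_zero n4 n4 n
    have h8 := qPoch_ne_zero (by rwa [norm_neg]) n2 (2 * n) (a := -q ^ 2)
    push_cast
    rw [show 2 * (n + 1) = 2 * n + 1 + 1 by ring, qPoch_self_succ, qPoch_succ, qPoch_succ,
      ← pow_mul, ← pow_mul, ← pow_mul, show -q ^ 2 * q ^ (2 * (2 * n)) = -q ^ (4 * n + 2) by ring,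
      show -q ^ 2 * q ^ (2 * (2 * n + 1)) = -q ^ (4 * n + 4) by ring,
      show 4 * (n + 1) = 4 * n + 4 by ring, sub_neg_eq_add, sub_neg_eq_add]
    rw [div_div, show (1 : ℂ) - (q ^ (4 * n + 4)) ^ 2 =
      (1 - q ^ (4 * n + 4)) * (1 + q ^ (4 * n + 4)) by ring] at h
    generalize q ^ (4 * n + 4) = x at *
    generalize q ^ (4 * n + 2) = y at *
    rw [eq_div_iff (by positivity)] at h ⊢
    linear_combination h

end RogersSelberg

/-! ### The Jacobi triple product -/

/-- The bilateral theta series `∑_{r ∈ ℤ} (-1)^r q^{t r² + c r}`. -/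
noncomputable def altTheta (q : ℂ) (t c : ℤ) : ℂ := ∑' r : ℤ, (-1) ^ r * q ^ (t * r ^ 2 + c * r)

section

variable {q : ℂ} (hq0 : q ≠ 0) (hq : ‖q‖ < 1)
include hq0 hq

theorem summable_altTheta {t : ℤ} (ht : 0 < t) (c : ℤ) :
    Summable (fun r : ℤ => (-1 : ℂ) ^ r * q ^ (t * r ^ 2 + c * r)) := by
  refine Summable.of_norm ?_
  simp only [norm_mul, norm_zpow, norm_neg, norm_one, one_zpow, one_mul]
  exact summable_zpow_quadratic (norm_pos_iff.2 hq0) hq ht c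

/-- As the row index grows, `bilat` tends to the theta series divided by `(Q; Q)_∞²`. -/
theorem tendsto_bilat {d : ℕ} (hd : d ≠ 0) {t : ℤ} (ht : 0 < t) (c : ℤ) :
    Tendsto (fun n : ℕ => bilat q d t c n n) atTop
      (𝓝 (altTheta q t c * ((qPochInf (q ^ d) (q ^ d))⁻¹ * (qPochInf (q ^ d) (q ^ d))⁻¹))) := by
  have hQ := norm_pow_lt_one hq hd
  obtain ⟨C, hC0, hC⟩ := exists_norm_invPoch_le hQ
  unfold altTheta
  rw [← tsum_mul_right]
  unfold bilat
  refine tendsto_tsum_of_dominated_convergence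
    (bound := fun r => ‖q‖ ^ (t * r ^ 2 + c * r) * (C * C))
    ((summable_zpow_quadratic (norm_pos_iff.2 hq0) hq ht c).mul_right _) (fun r => ?_)
    (Eventually.of_forall fun n r => ?_)
  · have h1 : Tendsto (fun n : ℕ => (n : ℤ) - r) atTop atTop :=
      tendsto_atTop_add_const_right _ _ tendsto_natCast_atTop_atTop
    have h2 : Tendsto (fun n : ℕ => (n : ℤ) + r) atTop atTop :=
      tendsto_atTop_add_const_right _ _ tendsto_natCast_atTop_atTop
    exact (((tendsto_invPoch hQ).comp h1).mul ((tendsto_invPoch hQ).comp h2)).const_mul _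
  · simp only [bilatTerm, norm_mul, norm_zpow, norm_neg, norm_one, one_zpow, one_mul]
    gcongr
    exacts [hC _, hC _]

theorem bilat_two_mul_left {t : ℕ} (ht : t ≠ 0) (c a b : ℤ) :
    (1 - q ^ (2 * t * (a + b))) * bilat q (2 * t) t c a b =
      (1 - q ^ (2 * t * a - t + c)) * bilat q (2 * t) t c (a - 1) b := by
  have h := bilat_pascal_left hq0 (norm_pow_lt_one hq (show 2 * t ≠ 0 by lia)) t c a b
  rw [bilat_shift hq0 t (c - (2 * t : ℕ)), sub_add_cancel] at h
  push_cast at h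
  rw [sub_add_cancel] at h
  rw [h, show (2 * t * a - t + c : ℤ) = 2 * t * a + (t + (c - 2 * t)) by ring,
    zpow_add₀ hq0 _ (t + _)]
  ring

theorem bilat_two_mul_right {t : ℕ} (ht : t ≠ 0) (c a b : ℤ) :
    (1 - q ^ (2 * t * (a + b))) * bilat q (2 * t) t c a b =
      (1 - q ^ (2 * t * b - t - c)) * bilat q (2 * t) t c a (b - 1) := by
  have h := bilat_two_mul_left hq0 hq ht (-c) b a
  rwa [bilat_swap t c a b, bilat_swap t c a, add_comm a b]

/-- The finite form of the Jacobi triple product. -/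
theorem bilat_two_mul_mul_qPoch {t c : ℕ} (ht : t ≠ 0) (hc : c ≤ t) (n : ℕ) :
    bilat q (2 * t) t c n n * qPoch (q ^ (2 * t)) (q ^ (2 * t)) (2 * n) =
      qPoch (q ^ (t + c)) (q ^ (2 * t)) n * qPoch (q ^ (t - c)) (q ^ (2 * t)) n := by
  induction n with
  | zero => simp [bilat_zero_zero, qPoch_zero]
  | succ n ih =>
    have h1 := bilat_two_mul_left hq0 hq ht c (n + 1) (n + 1)
    have h2 := bilat_two_mul_right hq0 hq ht c n (n + 1)
    rw [add_sub_cancel_right] at h1 h2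
    rw [show 2 * (n + 1) = 2 * n + 1 + 1 by ring, qPoch_self_succ, qPoch_self_succ, qPoch_succ,
      qPoch_succ]
    have e1 : q ^ (2 * t * ((n + 1) + (n + 1)) : ℤ) = (q ^ (2 * t)) ^ (2 * n + 1 + 1) := by
      rw [← pow_mul]; norm_cast; ring_nf
    have e2 : q ^ (2 * t * (n + (n + 1)) : ℤ) = (q ^ (2 * t)) ^ (2 * n + 1) := by
      rw [← pow_mul]; norm_cast; ring_nf
    have e3 : q ^ (2 * t * (n + 1) - t + c : ℤ) = q ^ (t + c) * (q ^ (2 * t)) ^ n := by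
      rw [← pow_mul, ← pow_add, ← zpow_natCast]; push_cast; ring_nf
    have e4 : q ^ (2 * t * (n + 1) - t - c : ℤ) = q ^ (t - c) * (q ^ (2 * t)) ^ n := by
      rw [← pow_mul, ← pow_add, ← zpow_natCast]; push_cast [hc]; ring_nf
    rw [e1, e3] at h1
    rw [e2, e4] at h2
    push_cast
    generalize (q ^ (2 * t)) ^ (2 * n + 1 + 1) = x at *
    generalize (q ^ (2 * t)) ^ (2 * n + 1) = y at *
    generalize q ^ (t + c) * (q ^ (2 * t)) ^ n = z at *
    generalize q ^ (t - c) * (q ^ (2 * t)) ^ n = w at *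
    linear_combination (qPoch (q ^ (2 * t)) (q ^ (2 * t)) (2 * n) * (1 - y)) * h1 +
      (qPoch (q ^ (2 * t)) (q ^ (2 * t)) (2 * n) * (1 - z)) * h2 + (1 - z) * (1 - w) * ih

/-- The Jacobi triple product, with integral exponents. -/
theorem altTheta_eq_qPochInf {t c : ℕ} (ht : t ≠ 0) (hc : c ≤ t) :
    altTheta q t c = qPochInf (q ^ (2 * t)) (q ^ (2 * t)) * qPochInf (q ^ (t + c)) (q ^ (2 * t)) *
      qPochInf (q ^ (t - c)) (q ^ (2 * t)) := by
  have hd : 2 * t ≠ 0 := by lia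
  have hQ := norm_pow_lt_one hq hd
  have h1 := (tendsto_bilat hq0 hq hd (t := t) (by lia) c).mul ((tendsto_qPoch hQ (q ^ (2 * t))).comp
    (tendsto_id.const_mul_atTop' (show (0 : ℕ) < 2 by norm_num)))
  have h2 := (tendsto_qPoch hQ (q ^ (t + c))).mul (tendsto_qPoch hQ (q ^ (t - c)))
  have h3 := tendsto_nhds_unique h1 (h2.congr fun n => (bilat_two_mul_mul_qPoch hq0 hq ht hc n).symm)
  have h4 := qPochInf_ne_zero hQ hQ
  rw [mul_assoc, ← h3]
  field_simp

end

/-! ### The Durfee rectangle identity and the limiting Bailey lemma -/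

/-- The summand of `∑_m q^{m² + km} / ((q; q)_m (q; q)_{m + k})`, for integers `k` and `m`. -/
noncomputable def durfeeTerm (q : ℂ) (k m : ℤ) : ℂ :=
  q ^ (m ^ 2 + k * m) * (invPoch q m * invPoch q (m + k))

section

variable {q : ℂ} (hq0 : q ≠ 0) (hq : ‖q‖ < 1)
include hq0 hq

theorem summable_zpow_mul_invPoch (k a b : ℤ) :
    Summable (fun m : ℤ => q ^ (m ^ 2 + k * m) * (invPoch q (m + a) * invPoch q (m + b))) := by
  obtain ⟨C, hC0, hC⟩ := exists_norm_invPoch_le hq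
  refine Summable.of_norm_bounded
    ((summable_zpow_quadratic (norm_pos_iff.2 hq0) hq one_pos k).mul_right (C * C)) fun m => ?_
  rw [norm_mul, norm_mul, norm_zpow, one_mul]
  gcongr
  exacts [hC _, hC _]

theorem summable_durfeeTerm (k : ℤ) : Summable (durfeeTerm q k) := by
  have h := summable_zpow_mul_invPoch hq0 hq k 0 k
  simp only [add_zero] at h
  exact h

theorem tsum_durfeeTerm_succ (k : ℤ) : ∑' m, durfeeTerm q (k + 1) m = ∑' m, durfeeTerm q k m := by
  -- The difference of the two summands is `G (m + 1) - G m` for the following summable `G`.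
  set G : ℤ → ℂ := fun m => -(q ^ (m ^ 2 + k * m) * (invPoch q (m + -1) * invPoch q (m + k)))
    with hG
  have hs : Summable G := (summable_zpow_mul_invPoch hq0 hq k (-1) k).neg
  have hs' : Summable (fun m => G (m + 1)) := (Equiv.addRight (1 : ℤ)).summable_iff.2 hs
  have h (m : ℤ) : durfeeTerm q k m - durfeeTerm q (k + 1) m = G (m + 1) - G m := by
    simp only [hG, durfeeTerm]
    rw [← sub_eq_add_neg m, ← one_sub_zpow_mul_invPoch hq m,
      show m + k = m + 1 + k - 1 by ring, ← one_sub_zpow_mul_invPoch hq (m + 1 + k),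
      show m + (k + 1) = m + 1 + k by ring, show m + 1 + -1 = m by ring,
      show m ^ 2 + (k + 1) * m = (m ^ 2 + k * m) + m by ring,
      show (m + 1) ^ 2 + k * (m + 1) = (m ^ 2 + k * m) + (m + (m + 1 + k)) by ring,
      zpow_add₀ hq0 (m ^ 2 + k * m), zpow_add₀ hq0 (m ^ 2 + k * m), zpow_add₀ hq0 m]
    ring
  have h2 := (summable_durfeeTerm hq0 hq k).tsum_sub (summable_durfeeTerm hq0 hq (k + 1))
  simp only [h] at h2
  have hshift : ∑' m, G (m + 1) = ∑' m, G m := (Equiv.addRight (1 : ℤ)).tsum_eq G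
  rw [hs'.tsum_sub hs, hshift, sub_self] at h2
  exact (sub_eq_zero.1 h2.symm).symm

theorem tendsto_tsum_durfeeTerm :
    Tendsto (fun n : ℕ => ∑' m, durfeeTerm q n m) atTop (𝓝 (qPochInf q q)⁻¹) := by
  obtain ⟨C, hC0, hC⟩ := exists_norm_invPoch_le hq
  rw [← tsum_ite_eq (0 : ℤ) (fun _ => (qPochInf q q)⁻¹)]
  refine tendsto_tsum_of_dominated_convergence
    (bound := fun m => ‖q‖ ^ (1 * m ^ 2 + 0 * m) * (C * C))
    ((summable_zpow_quadratic (norm_pos_iff.2 hq0) hq one_pos 0).mul_right _) (fun m => ?_)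
    (Eventually.of_forall fun n m => ?_)
  · have hu : Tendsto (fun n : ℕ => invPoch q (m + n)) atTop (𝓝 (qPochInf q q)⁻¹) :=
      (tendsto_invPoch hq).comp (tendsto_atTop_add_const_left _ _ tendsto_natCast_atTop_atTop)
    rcases lt_trichotomy m 0 with hm | rfl | hm
    · simp [durfeeTerm, invPoch_of_neg q hm, hm.ne]
    · simpa [durfeeTerm, invPoch_zero] using hu
    · rw [if_neg hm.ne']
      lift m to ℕ using hm.le
      have hp : Tendsto (fun n : ℕ => (q ^ m) ^ n) atTop (𝓝 0) :=
        tendsto_pow_atTop_nhds_zero_of_norm_lt_one (norm_pow_lt_one hq (by lia))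
      have h := (hp.mul (hu.const_mul (invPoch q m))).const_mul (q ^ (m ^ 2))
      rw [zero_mul, mul_zero] at h
      refine h.congr fun n => ?_
      unfold durfeeTerm
      rw [← mul_assoc, ← pow_mul, ← pow_add]
      congr 1
      rw [← zpow_natCast]
      push_cast
      ring_nf
  · rcases lt_or_ge m 0 with hm | hm
    · rw [durfeeTerm, invPoch_of_neg q hm, zero_mul, mul_zero, norm_zero]
      positivity
    · rw [durfeeTerm, norm_mul, norm_mul, norm_zpow]
      gcongr ?_ * (?_ * ?_)
      · refine zpow_le_zpow_right_of_le_one₀ (norm_pos_iff.2 hq0) hq.le ?_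
        have : 0 ≤ (n : ℤ) * m := by positivity
        linarith
      exacts [hC _, hC _]

/-- The bilateral form of Cauchy's Durfee rectangle identity: the sum does not depend on `k`. -/
theorem tsum_durfeeTerm (k : ℤ) : ∑' m, durfeeTerm q k m = (qPochInf q q)⁻¹ := by
  have h (k : ℤ) : ∑' m, durfeeTerm q k m = ∑' m, durfeeTerm q 0 m := by
    induction k with
    | zero => rfl
    | succ k ih => rw [tsum_durfeeTerm_succ hq0 hq, ih]
    | pred k ih => rw [← ih, ← tsum_durfeeTerm_succ hq0 hq, sub_add_cancel]
  rw [h]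
  refine tendsto_nhds_unique ?_ (tendsto_tsum_durfeeTerm hq0 hq)
  simp only [h]
  exact tendsto_const_nhds

theorem summable_bailey (c e : ℤ) :
    Summable (fun p : ℤ × ℤ => q ^ (4 * p.1 ^ 2 + 4 * e * p.1) *
      bilatTerm q 4 3 c p.1 (p.1 + e) p.2) := by
  obtain ⟨C, hC0, hC⟩ := exists_norm_invPoch_le (norm_pow_lt_one hq four_ne_zero)
  have hx := norm_pos_iff.2 hq0
  have h := (summable_zpow_quadratic hx hq (t := 4) (by norm_num) (4 * e)).mul_of_nonneg
    (summable_zpow_quadratic hx hq (t := 3) (by norm_num) c)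
    (fun _ => (zpow_pos hx _).le) (fun _ => (zpow_pos hx _).le)
  refine Summable.of_norm_bounded (h.mul_right (C * C)) fun p => ?_
  simp only [bilatTerm, norm_mul, norm_zpow, norm_neg, norm_one, one_zpow, one_mul]
  rw [← mul_assoc]
  gcongr
  exacts [hC _, hC _]

/-- After the substitution `n = m + r`, the sum over `n` is the Durfee series with `k = 2r + e`. -/
theorem hasSum_bailey_inner (c e r : ℤ) :
    HasSum (fun n : ℤ => q ^ (4 * n ^ 2 + 4 * e * n) * bilatTerm q 4 3 c n (n + e) r)
      ((-1) ^ r * q ^ (7 * r ^ 2 + (c + 4 * e) * r) * (qPochInf (q ^ 4) (q ^ 4))⁻¹) := by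
  have hQ := norm_pow_lt_one hq four_ne_zero
  have hQ0 : q ^ 4 ≠ 0 := pow_ne_zero _ hq0
  rw [← tsum_durfeeTerm hQ0 hQ (2 * r + e), ← (Equiv.addRight r).hasSum_iff]
  refine ((summable_durfeeTerm hQ0 hQ (2 * r + e)).hasSum.mul_left _).congr_fun fun m => ?_
  simp only [Function.comp_apply, Equiv.coe_addRight, bilatTerm, durfeeTerm, pow_zpow_eq]
  rw [add_sub_cancel_right, show m + r + e + r = m + (2 * r + e) by ring]
  have : q ^ (4 * (m + r) ^ 2 + 4 * e * (m + r)) * q ^ (3 * r ^ 2 + c * r) =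
      q ^ (7 * r ^ 2 + (c + 4 * e) * r) * q ^ ((4 : ℕ) * (m ^ 2 + (2 * r + e) * m)) := by
    rw [← zpow_add₀ hq0, ← zpow_add₀ hq0]
    push_cast
    ring_nf
  linear_combination (-1) ^ r * (invPoch (q ^ 4) m * invPoch (q ^ 4) (m + (2 * r + e))) * this

/-- The limiting case of the Bailey lemma. The bound on `e` makes the terms with negative `n`
vanish, so that the sum over `ℤ` is one over `ℕ`. -/
theorem hasSum_bailey (c : ℤ) {e : ℤ} (he : e ≤ 1) :
    HasSum (fun n : ℕ => q ^ (4 * n ^ 2 + 4 * e * n : ℤ) * bilat q 4 3 c n (n + e))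
      (altTheta q 7 (c + 4 * e) * (qPochInf (q ^ 4) (q ^ 4))⁻¹) := by
  have hs := summable_bailey hq0 hq c e
  have hg (n : ℤ) : HasSum (fun r => q ^ (4 * n ^ 2 + 4 * e * n) * bilatTerm q 4 3 c n (n + e) r)
      (q ^ (4 * n ^ 2 + 4 * e * n) * bilat q 4 3 c n (n + e)) :=
    (summable_bilatTerm 3 c n (n + e)).hasSum.mul_left _
  have h1 := hs.hasSum.prod_fiberwise hg
  have h2 := ((Equiv.prodComm ℤ ℤ).hasSum_iff.2 hs.hasSum).prod_fiberwise fun r =>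
    hasSum_bailey_inner hq0 hq c e r
  have h3 : HasSum _ (altTheta q 7 (c + 4 * e) * (qPochInf (q ^ 4) (q ^ 4))⁻¹) :=
    (summable_altTheta hq0 hq (t := 7) (by norm_num) (c + 4 * e)).hasSum.mul_right _
  have h4 := h2.unique h3
  rw [h4] at h1
  refine ((Nat.cast_injective (R := ℤ)).hasSum_iff fun n hn => ?_).2 h1
  have hn0 : n < 0 := by
    by_contra h
    exact hn ⟨n.toNat, by lia⟩
  have hn1 : n + (n + e) < 0 := by lia
  rw [bilat_neg_left hn1, mul_zero]

end

/-! ### Euler's identity -/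

/-- The summand `q^{j² + j + 2jk} / (q²; q²)_j` of Euler's series for `(-q^{2k+2}; q²)_∞`. -/
noncomputable def eulerTerm (q : ℂ) (k j : ℕ) : ℂ :=
  q ^ (j ^ 2 + j + 2 * j * k) * (qPoch (q ^ 2) (q ^ 2) j)⁻¹

section

variable {q : ℂ} (hq : ‖q‖ < 1)
include hq

theorem exists_norm_eulerTerm_le : ∃ C : ℝ, ∀ k j : ℕ, ‖eulerTerm q k j‖ ≤ ‖q‖ ^ j * C := by
  have h2 := norm_pow_lt_one hq two_ne_zero
  obtain ⟨C, hC0, hC⟩ := exists_norm_inv_qPoch_le h2 h2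
  refine ⟨C, fun k j => ?_⟩
  rw [eulerTerm, norm_mul, norm_pow]
  gcongr ?_ * ?_
  · exact pow_le_pow_of_le_one (norm_nonneg q) hq.le (by nlinarith [Nat.zero_le (2 * j * k)])
  · exact hC _

theorem summable_eulerTerm (k : ℕ) : Summable (eulerTerm q k) := by
  obtain ⟨C, hC⟩ := exists_norm_eulerTerm_le hq
  exact Summable.of_norm_bounded
    ((summable_geometric_of_lt_one (norm_nonneg q) hq).mul_right C) (hC k)

/-- Termwise, the difference of the series for `k` and `k + 1` is a shift of the latter. -/
theorem tsum_eulerTerm_eq (k : ℕ) :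
    ∑' j, eulerTerm q k j = (1 + q ^ (2 * k + 2)) * ∑' j, eulerTerm q (k + 1) j := by
  have h0 := summable_eulerTerm hq k
  have h1 := summable_eulerTerm hq (k + 1)
  have h2 : ∑' j, eulerTerm q k j - ∑' j, eulerTerm q (k + 1) j =
      q ^ (2 * k + 2) * ∑' j, eulerTerm q (k + 1) j := by
    rw [← h0.tsum_sub h1, (h0.sub h1).tsum_eq_zero_add, ← tsum_mul_left]
    have hz : eulerTerm q k 0 - eulerTerm q (k + 1) 0 = 0 := by simp [eulerTerm]
    rw [hz, zero_add]
    refine tsum_congr fun j => ?_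
    simp only [eulerTerm]
    have n2 := norm_pow_lt_one hq two_ne_zero
    have n3 := one_sub_ne_zero_of_norm_lt_one (norm_pow_lt_one n2 j.succ_ne_zero)
    have n4 := qPoch_ne_zero n2 n2 j
    rw [qPoch_self_succ]
    field_simp
    ring
  linear_combination h2

theorem qPoch_mul_tsum_eulerTerm (k : ℕ) :
    qPoch (-q ^ 2) (q ^ 2) k * ∑' j, eulerTerm q k j = ∑' j, eulerTerm q 0 j := by
  induction k with
  | zero => rw [qPoch_zero, one_mul]
  | succ k ih =>
    rw [← ih, tsum_eulerTerm_eq hq k, qPoch_succ]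
    ring

theorem tendsto_tsum_eulerTerm :
    Tendsto (fun k : ℕ => ∑' j, eulerTerm q k j) atTop (𝓝 1) := by
  obtain ⟨C, hC⟩ := exists_norm_eulerTerm_le hq
  rw [← tsum_ite_eq (0 : ℕ) (fun _ => (1 : ℂ))]
  refine tendsto_tsum_of_dominated_convergence
    ((summable_geometric_of_lt_one (norm_nonneg q) hq).mul_right C) (fun j => ?_)
    (Eventually.of_forall hC)
  rcases eq_or_ne j 0 with rfl | hj
  · simp [eulerTerm, qPoch_zero]
  · rw [if_neg hj]
    have hp : Tendsto (fun k : ℕ => (q ^ (2 * j)) ^ k) atTop (𝓝 0) :=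
      tendsto_pow_atTop_nhds_zero_of_norm_lt_one (norm_pow_lt_one hq (by lia))
    have h := (hp.const_mul (q ^ (j ^ 2 + j))).mul_const (qPoch (q ^ 2) (q ^ 2) j)⁻¹
    rw [mul_zero, zero_mul] at h
    refine h.congr fun k => ?_
    rw [eulerTerm, ← pow_mul, ← pow_add]

/-- Euler's expansion of `(-q^{2k+2}; q²)_∞`. -/
theorem tsum_eulerTerm (k : ℕ) :
    ∑' j, eulerTerm q k j = qPochInf (-q ^ 2) (q ^ 2) / qPoch (-q ^ 2) (q ^ 2) k := by
  have n2 := norm_pow_lt_one hq two_ne_zero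
  have h := (tendsto_qPoch n2 (-q ^ 2)).mul (tendsto_tsum_eulerTerm hq)
  simp only [qPoch_mul_tsum_eulerTerm hq, mul_one] at h
  rw [eq_div_iff (qPoch_ne_zero (by rwa [norm_neg]) n2 k), mul_comm,
    qPoch_mul_tsum_eulerTerm hq]
  exact tendsto_nhds_unique tendsto_const_nhds h

end

/-! ### Rearranging the double series -/

section PowerSeries

open PowerSeries

/-- The generating function `∑ yⁿ Xⁿ / (q; q)_n` of Euler, that is `1 / (yX; q)_∞`. -/
noncomputable def eulerSeries (q y : ℂ) : ℂ⟦X⟧ := mk fun n => y ^ n * (qPoch q q n)⁻¹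

/-- The coefficient `y^{2n} / (q⁴; q⁴)_n` at the even index `2n`, and `0` at odd indices. -/
noncomputable def evenCoeff (q y : ℂ) (i : ℕ) : ℂ :=
  if Even i then y ^ i * (qPoch (q ^ 4) (q ^ 4) (i / 2))⁻¹ else 0

/-- The generating function `∑ (yX)^{2n} / (q⁴; q⁴)_n`, that is `1 / (y²X²; q⁴)_∞`. -/
noncomputable def evenEulerSeries (q y : ℂ) : ℂ⟦X⟧ := mk (evenCoeff q y)

theorem rescale_eulerSeries {q : ℂ} (hq : ‖q‖ < 1) (y : ℂ) :
    rescale q (eulerSeries q y) = (1 - C y * X) * eulerSeries q y := by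
  ext n
  rw [sub_mul, one_mul, mul_assoc, map_sub, coeff_C_mul, coeff_rescale]
  rcases n with _ | n
  · simp [eulerSeries]
  · rw [coeff_succ_X_mul]
    simp only [eulerSeries, coeff_mk]
    have h1 := one_sub_ne_zero_of_norm_lt_one (norm_pow_lt_one hq n.succ_ne_zero)
    have h2 := qPoch_ne_zero hq hq n
    rw [qPoch_self_succ]
    field_simp
    ring

theorem rescale_evenEulerSeries {q : ℂ} (hq : ‖q‖ < 1) (y : ℂ) :
    rescale (q ^ 2) (evenEulerSeries q y) =
      (1 - C y * X) * (1 + C y * X) * evenEulerSeries q y := by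
  have hP : (1 - C y * X) * (1 + C y * X) * evenEulerSeries q y =
      evenEulerSeries q y - C (y ^ 2) * (X * (X * evenEulerSeries q y)) := by
    rw [map_pow]; ring
  rw [hP]
  ext n
  rw [map_sub, coeff_C_mul, coeff_rescale]
  rcases n with _ | _ | n
  · simp [evenEulerSeries, evenCoeff]
  · simp [evenEulerSeries, evenCoeff]
  · rw [coeff_succ_X_mul, coeff_succ_X_mul]
    simp only [evenEulerSeries, coeff_mk, evenCoeff]
    simp only [show n + 1 + 1 = n + 2 by ring, Nat.even_add, even_two, iff_true]
    split_ifs with h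
    · obtain ⟨m, rfl⟩ := h.two_dvd
      have n4 := norm_pow_lt_one hq four_ne_zero
      have h1 := one_sub_ne_zero_of_norm_lt_one (norm_pow_lt_one n4 m.succ_ne_zero)
      have h2 := qPoch_ne_zero n4 n4 m
      rw [show (2 * m + 2) / 2 = m + 1 by lia, show 2 * m / 2 = m by lia, qPoch_self_succ]
      field_simp
      ring
    · simp

/-- A solution of `F(aX) = P(X) F(X)` with `P(0) = 1` is determined by its constant term. -/
theorem eq_of_rescale_eq_mul {a : ℂ} (ha : ‖a‖ < 1) {P F G : ℂ⟦X⟧} (hP : constantCoeff P = 1)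
    (hF : rescale a F = P * F) (hG : rescale a G = P * G)
    (h0 : constantCoeff F = constantCoeff G) : F = G := by
  rw [← sub_eq_zero]
  have hH : rescale a (F - G) = P * (F - G) := by rw [map_sub, hF, hG, mul_sub]
  have hH0 : constantCoeff (F - G) = 0 := by rw [map_sub, h0, sub_self]
  generalize F - G = H at hH hH0
  have hdvd (n : ℕ) : (X : ℂ⟦X⟧) ^ (n + 1) ∣ H := by
    induction n with
    | zero => rw [zero_add, pow_one, X_dvd_iff, hH0]
    | succ n ih =>
      obtain ⟨K, rfl⟩ := ih
      rw [pow_succ _ (n + 1)]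
      refine mul_dvd_mul_left _ (X_dvd_iff.2 ?_)
      -- Compare the coefficients of `X ^ (n + 1)`: `a ^ (n + 1) K(0) = K(0)`, so `K(0) = 0`.
      have h1 : X ^ (n + 1) * (C (a ^ (n + 1)) * rescale a K) = X ^ (n + 1) * (P * K) := by
        rw [map_mul, map_pow, rescale_X] at hH
        rw [map_pow]
        linear_combination hH
      have h2 := congrArg constantCoeff (mul_left_cancel₀ (pow_ne_zero _ X_ne_zero) h1)
      rw [map_mul, map_mul, hP, constantCoeff_C, ← coeff_zero_eq_constantCoeff_apply,
        coeff_rescale, pow_zero, one_mul, one_mul, coeff_zero_eq_constantCoeff_apply] at h2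
      have h3 := one_sub_ne_zero_of_norm_lt_one (norm_pow_lt_one ha n.succ_ne_zero)
      exact (mul_eq_zero.1 (show (1 - a ^ (n + 1)) * constantCoeff K = 0 by
        linear_combination -h2)).resolve_left h3
  ext n
  exact X_pow_dvd_iff.1 (hdvd n) n n.lt_succ_self

/-- For `{y, z} = {1, q}` both sides have the infinite product
`1 / ((X; q)_∞ (-yX; q²)_∞) = 1 / ((y²X²; q⁴)_∞ (zX; q²)_∞)`. -/
theorem eulerSeries_mul_eulerSeries {q : ℂ} (hq : ‖q‖ < 1) {y z : ℂ} (hyz : y * z = q)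
    (hyz' : y + z = 1 + q) :
    eulerSeries q 1 * eulerSeries (q ^ 2) (-y) =
      evenEulerSeries q y * eulerSeries (q ^ 2) z := by
  have n2 := norm_pow_lt_one hq two_ne_zero
  have hC : (C y : ℂ⟦X⟧) * C z = C q := by rw [← map_mul, hyz]
  have hC' : (C y : ℂ⟦X⟧) + C z = 1 + C q := by rw [← map_add, hyz', map_add, map_one]
  refine eq_of_rescale_eq_mul n2
    (P := (1 - C y * X) * (1 + C y * X) * (1 - C z * X)) (by simp) ?_ ?_ ?_
  · have h1 : rescale (q ^ 2) (eulerSeries q 1) =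
        (1 - C q * X) * (1 - X) * eulerSeries q 1 := by
      rw [pow_two, ← rescale_rescale, rescale_eulerSeries hq, map_mul, rescale_eulerSeries hq,
        map_one, one_mul, map_sub, map_one, rescale_X]
      ring
    rw [map_mul, h1, rescale_eulerSeries n2, map_neg]
    linear_combination (eulerSeries q 1 * eulerSeries (q ^ 2) (-y) * (1 + C y * X)) *
      (X * hC' - X ^ 2 * hC)
  · rw [map_mul, rescale_evenEulerSeries hq, rescale_eulerSeries n2]
    ring
  · rw [map_mul, map_mul]
    simp only [← coeff_zero_eq_constantCoeff_apply]
    simp [eulerSeries, evenEulerSeries, evenCoeff, qPoch_zero, -coeff_zero_eq_constantCoeff]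

end PowerSeries

/-- A summable double series may be replaced by any other with the same diagonal sums. -/
theorem hasSum_of_sum_antidiagonal_eq {f g : ℕ × ℕ → ℂ} {s : ℂ} (hf : Summable f)
    (hg : HasSum g s)
    (h : ∀ N, ∑ p ∈ Finset.HasAntidiagonal.antidiagonal N, f p =
      ∑ p ∈ Finset.HasAntidiagonal.antidiagonal N, g p) :
    HasSum f s := by
  have key {u : ℕ × ℕ → ℂ} {a : ℂ} (hu : HasSum u a) :
      HasSum (fun N => ∑ p ∈ Finset.HasAntidiagonal.antidiagonal N, u p) a := by
    refine (Finset.HasAntidiagonal.sigmaAntidiagonalEquivProd.hasSum_iff.2 hu).sigma fun N => ?_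
    exact Finset.hasSum (Finset.HasAntidiagonal.antidiagonal N) u
  have h1 := key hf.hasSum
  simp only [h] at h1
  rw [(key hg).unique h1]
  exact hf.hasSum

section

variable {q : ℂ} (hq : ‖q‖ < 1)
include hq

theorem summable_pow_mul_mul (k : ℕ) {a b : ℕ → ℂ} {A B : ℝ} (ha : ∀ n, ‖a n‖ ≤ A)
    (hb : ∀ n, ‖b n‖ ≤ B) :
    Summable (fun p : ℕ × ℕ => q ^ ((p.1 + p.2) ^ 2 + k * (p.1 + p.2)) * (a p.1 * b p.2)) := by
  have hg := summable_geometric_of_lt_one (norm_nonneg q) hq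
  refine Summable.of_norm_bounded ((hg.mul_of_nonneg hg (fun _ => by positivity)
    (fun _ => by positivity)).mul_right (A * B)) fun p => ?_
  rw [norm_mul, norm_mul, norm_pow, ← pow_add]
  have hA := (norm_nonneg _).trans (ha 0)
  gcongr ?_ * (?_ * ?_)
  · exact pow_le_pow_of_le_one (norm_nonneg q) hq.le
      (by nlinarith [Nat.le_self_pow two_ne_zero (p.1 + p.2)])
  exacts [ha _, hb _]

end

theorem norm_pow_mul_le {w u : ℂ} {c : ℝ} (hw : ‖w‖ ≤ 1) (hu : ‖u‖ ≤ c) (n : ℕ) :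
    ‖w ^ n * u‖ ≤ c := by
  rw [norm_mul, norm_pow]
  exact (mul_le_of_le_one_left (norm_nonneg u) (pow_le_one₀ (norm_nonneg w) hw)).trans hu

theorem exists_norm_evenCoeff_le {q : ℂ} (hq : ‖q‖ < 1) {y : ℂ} (hy : ‖y‖ ≤ 1) :
    ∃ C, ∀ i, ‖evenCoeff q y i‖ ≤ C := by
  have n4 := norm_pow_lt_one hq four_ne_zero
  obtain ⟨C, hC0, hC⟩ := exists_norm_inv_qPoch_le n4 n4
  refine ⟨C, fun i => ?_⟩
  unfold evenCoeff
  split_ifs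
  · exact norm_pow_mul_le hy (hC _) i
  · simpa using hC0

theorem exists_norm_pow_mul_inv_qPoch_le {q : ℂ} (hq : ‖q‖ < 1) {z : ℂ} (hz : ‖z‖ ≤ 1) :
    ∃ C, ∀ i, ‖z ^ i * (qPoch q q i)⁻¹‖ ≤ C := by
  obtain ⟨C, -, hC⟩ := exists_norm_inv_qPoch_le hq hq
  exact ⟨C, fun i => norm_pow_mul_le hz (hC i) i⟩

theorem evenCoeff_mul_eq {q y z : ℂ} {k l e : ℕ} (hyk : y * q ^ k = q ^ (2 * e))
    (hzk : z * q ^ k = q ^ (2 * l + 1)) (n j : ℕ) :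
    q ^ ((2 * n + j) ^ 2 + k * (2 * n + j)) *
        (evenCoeff q y (2 * n) * (z ^ j * (qPoch (q ^ 2) (q ^ 2) j)⁻¹)) =
      q ^ (4 * n ^ 2 + 4 * e * n) * (qPoch (q ^ 4) (q ^ 4) n)⁻¹ * eulerTerm q (2 * n + l) j := by
  have e1 : y ^ (2 * n) * q ^ (k * (2 * n)) = q ^ (4 * e * n) := by
    rw [pow_mul q k, ← mul_pow, hyk, ← pow_mul]; ring_nf
  have e2 : z ^ j * q ^ (k * j) = q ^ ((2 * l + 1) * j) := by
    rw [pow_mul q k, ← mul_pow, hzk, ← pow_mul]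
  rw [evenCoeff, eulerTerm, if_pos (even_two_mul n), Nat.mul_div_cancel_left n two_pos,
    show (2 * n + j) ^ 2 + k * (2 * n + j) =
      4 * n ^ 2 + (j ^ 2 + 4 * n * j) + k * (2 * n) + k * j by ring,
    show j ^ 2 + j + 2 * j * (2 * n + l) = (j ^ 2 + 4 * n * j) + (2 * l + 1) * j by ring,
    pow_add, pow_add, pow_add, pow_add q (4 * n ^ 2) (4 * e * n), pow_add _ _ ((2 * l + 1) * j),
    ← e1, ← e2]
  ring

/-- Summing over `j` by Euler's identity leaves a simple series. -/
theorem hasSum_evenCoeff_mul {q : ℂ} (hq : ‖q‖ < 1) {y z s : ℂ} {k l e : ℕ}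
    (hy : ‖y‖ ≤ 1) (hz : ‖z‖ ≤ 1) (hyk : y * q ^ k = q ^ (2 * e))
    (hzk : z * q ^ k = q ^ (2 * l + 1))
    (hs : HasSum (fun n : ℕ => q ^ (4 * n ^ 2 + 4 * e * n) * (qPoch (q ^ 4) (q ^ 4) n)⁻¹ *
      (qPochInf (-q ^ 2) (q ^ 2) / qPoch (-q ^ 2) (q ^ 2) (2 * n + l))) s) :
    HasSum (fun p : ℕ × ℕ => q ^ ((p.1 + p.2) ^ 2 + k * (p.1 + p.2)) *
      (evenCoeff q y p.1 * (z ^ p.2 * (qPoch (q ^ 2) (q ^ 2) p.2)⁻¹))) s := by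
  obtain ⟨A, hA⟩ := exists_norm_evenCoeff_le hq hy
  obtain ⟨B, hB⟩ := exists_norm_pow_mul_inv_qPoch_le (norm_pow_lt_one hq two_ne_zero) hz
  have hg := summable_pow_mul_mul hq k hA hB
  have h2 := hg.hasSum.prod_fiberwise fun i => (hg.prod_factor i).hasSum
  have h3 := ((mul_right_injective₀ (two_ne_zero' ℕ)).hasSum_iff fun i hi => ?_).2 h2
  · have h4 := h3.congr_fun (g := fun n : ℕ => q ^ (4 * n ^ 2 + 4 * e * n) *
      (qPoch (q ^ 4) (q ^ 4) n)⁻¹ * (qPochInf (-q ^ 2) (q ^ 2) /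
        qPoch (-q ^ 2) (q ^ 2) (2 * n + l))) fun n => ?_
    · rw [hs.unique h4]
      exact hg.hasSum
    · simp only [Function.comp_apply, evenCoeff_mul_eq hyk hzk]
      rw [tsum_mul_left, tsum_eulerTerm hq]
  · have hodd : ¬ Even i := fun h => hi (by obtain ⟨m, rfl⟩ := h.two_dvd; exact ⟨m, rfl⟩)
    simp [evenCoeff, hodd]

/-- Reduction of the double series to a simple one: for fixed `m + n` the coefficients are
rearranged by `eulerSeries_mul_eulerSeries`. -/
theorem hasSum_double_series {q : ℂ} (hq : ‖q‖ < 1) {y z s : ℂ} {k l e : ℕ} (hyz : y * z = q)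
    (hyz' : y + z = 1 + q) (hy : ‖y‖ ≤ 1) (hz : ‖z‖ ≤ 1) (hyk : y * q ^ k = q ^ (2 * e))
    (hzk : z * q ^ k = q ^ (2 * l + 1))
    (hs : HasSum (fun n : ℕ => q ^ (4 * n ^ 2 + 4 * e * n) * (qPoch (q ^ 4) (q ^ 4) n)⁻¹ *
      (qPochInf (-q ^ 2) (q ^ 2) / qPoch (-q ^ 2) (q ^ 2) (2 * n + l))) s) :
    HasSum (fun p : ℕ × ℕ => q ^ ((p.1 + p.2) ^ 2 + k * (p.1 + p.2)) *
      ((qPoch q q p.1)⁻¹ * ((-y) ^ p.2 * (qPoch (q ^ 2) (q ^ 2) p.2)⁻¹))) s := by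
  obtain ⟨A, -, hA⟩ := exists_norm_inv_qPoch_le hq hq
  obtain ⟨B, hB⟩ := exists_norm_pow_mul_inv_qPoch_le (norm_pow_lt_one hq two_ne_zero)
    (z := -y) (by rwa [norm_neg])
  have hf := summable_pow_mul_mul hq k hA hB
  have hg := hasSum_evenCoeff_mul hq hy hz hyk hzk hs
  refine hasSum_of_sum_antidiagonal_eq hf hg fun N => ?_
  have h1 := congrArg (PowerSeries.coeff N) (eulerSeries_mul_eulerSeries hq hyz hyz')
  rw [PowerSeries.coeff_mul, PowerSeries.coeff_mul] at h1
  simp only [eulerSeries, evenEulerSeries, PowerSeries.coeff_mk, one_pow, one_mul] at h1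
  have h2 (a : ℕ → ℕ → ℂ) : ∑ p ∈ Finset.HasAntidiagonal.antidiagonal N,
      q ^ ((p.1 + p.2) ^ 2 + k * (p.1 + p.2)) * a p.1 p.2 =
      q ^ (N ^ 2 + k * N) * ∑ p ∈ Finset.HasAntidiagonal.antidiagonal N, a p.1 p.2 := by
    rw [Finset.mul_sum]
    refine Finset.sum_congr rfl fun p hp => ?_
    rw [Finset.HasAntidiagonal.mem_antidiagonal.1 hp]
  rw [h2 fun m n => (qPoch q q m)⁻¹ * ((-y) ^ n * (qPoch (q ^ 2) (q ^ 2) n)⁻¹), h1,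
    h2 fun m n => evenCoeff q y m * (z ^ n * (qPoch (q ^ 2) (q ^ 2) n)⁻¹)]

/-! ### The Rogers–Selberg identities -/

section

variable {q : ℂ} (hq : ‖q‖ < 1)
include hq

theorem qPochInf_neg_mul_altTheta (s : ℂ) :
    qPochInf (-q ^ 2) (q ^ 2) * (s * (qPochInf (q ^ 4) (q ^ 4))⁻¹) =
      s / qPochInf (q ^ 2) (q ^ 2) := by
  have n2 := norm_pow_lt_one hq two_ne_zero
  have h := qPochInf_neg_mul_qPochInf n2
  rw [← pow_mul] at h
  have h1 := qPochInf_ne_zero (a := -q ^ 2) (by rwa [norm_neg]) n2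
  have h2 := qPochInf_ne_zero n2 n2
  rw [← h]
  field_simp

variable (hq0 : q ≠ 0)
include hq0

/-- The triple product cancels three of the seven
factors of `(q²; q²)_∞`. -/
theorem altTheta_div_qPochInf (c : ℕ) (hc : c ≤ 7) :
    altTheta q 7 c / qPochInf (q ^ 2) (q ^ 2) =
      qPochInf (q ^ (7 + c)) (q ^ 14) * qPochInf (q ^ (7 - c)) (q ^ 14) /
        (qPochInf (q ^ 2) (q ^ 14) * qPochInf (q ^ 4) (q ^ 14) * qPochInf (q ^ 6) (q ^ 14) *
          qPochInf (q ^ 8) (q ^ 14) * qPochInf (q ^ 10) (q ^ 14) * qPochInf (q ^ 12) (q ^ 14)) := by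
  have n14 := norm_pow_lt_one hq (show 14 ≠ 0 by norm_num)
  have h1 := altTheta_eq_qPochInf hq0 hq (t := 7) (by norm_num) hc
  have h2 := qPochInf_self_eq_prod_seven (norm_pow_lt_one hq two_ne_zero)
  simp only [← pow_mul] at h2
  norm_num at h1 h2
  rw [h1, h2, mul_assoc, mul_comm (qPochInf (q ^ 14) (q ^ 14)),
    mul_div_mul_right _ _ (qPochInf_ne_zero n14 n14)]

/-- A closed form of the row sums `bilat` gives an identity of Rogers–Selberg type. -/
theorem hasSum_rogersSelberg_of_bilat_eq {c : ℤ} {e l c' : ℕ} (he : e ≤ 1)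
    (h : ∀ n : ℕ, bilat q 4 3 c n (n + e) =
      1 / (qPoch (q ^ 4) (q ^ 4) n * qPoch (-q ^ 2) (q ^ 2) (2 * n + l)))
    (hc : c + 4 * e = c') :
    HasSum (fun n : ℕ => q ^ (4 * n ^ 2 + 4 * e * n) * (qPoch (q ^ 4) (q ^ 4) n)⁻¹ *
      (qPochInf (-q ^ 2) (q ^ 2) / qPoch (-q ^ 2) (q ^ 2) (2 * n + l)))
      (altTheta q 7 c' / qPochInf (q ^ 2) (q ^ 2)) := by
  have h1 := (hasSum_bailey hq0 hq c (e := e) (by lia)).mul_left (qPochInf (-q ^ 2) (q ^ 2))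
  rw [qPochInf_neg_mul_altTheta hq, hc] at h1
  refine h1.congr_fun fun n => ?_
  have hp : q ^ (4 * (n : ℤ) ^ 2 + 4 * e * n) = q ^ (4 * n ^ 2 + 4 * e * n) := by
    rw [← zpow_natCast]; push_cast; rfl
  rw [h, hp]
  ring

end

theorem qPochInf_zero_right (a : ℂ) : qPochInf a 0 = 1 - a := by
  rw [qPochInf_eq_tprod (by simp), tprod_eq_mulSingle 0 fun j hj => by simp [hj]]
  simp [sub_eq_add_neg]

/-- The degenerate case `q = 0` of the Rogers–Selberg identities. -/
theorem hasSum_rogersSelberg_zero (e l : ℕ) :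
    HasSum (fun n : ℕ => (0 : ℂ) ^ (4 * n ^ 2 + 4 * e * n) * (qPoch (0 ^ 4) (0 ^ 4) n)⁻¹ *
      (qPochInf (-0 ^ 2) (0 ^ 2) / qPoch (-0 ^ 2) (0 ^ 2) (2 * n + l))) 1 := by
  have h (n : ℕ) : qPoch 0 0 n = 1 := by simp [qPoch]
  convert hasSum_single 0 fun n hn => ?_ using 1
  · simp [h, qPochInf_zero_right]
  · simp [hn]

section

variable {q : ℂ} (hq : ‖q‖ < 1)
include hq

theorem qPochInf_pow_ne_zero {i : ℕ} (hi : i ≠ 0) : qPochInf (q ^ i) (q ^ 14) ≠ 0 :=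
  qPochInf_ne_zero (norm_pow_lt_one hq hi) (norm_pow_lt_one hq (by norm_num))

/-- The Rogers–Selberg identity with series `∑ p^{2n²} / ((p²; p²)_n (-p; p)_{2n})`,
multiplied by `(-p; p)_∞`, for `p = q²`. -/
theorem hasSum_rogersSelberg_one :
    HasSum (fun n : ℕ => q ^ (4 * n ^ 2 + 4 * 0 * n) * (qPoch (q ^ 4) (q ^ 4) n)⁻¹ *
      (qPochInf (-q ^ 2) (q ^ 2) / qPoch (-q ^ 2) (q ^ 2) (2 * n + 0)))
      (1 / qPochInf₄ (q ^ 2) (q ^ 4) (q ^ 10) (q ^ 12) (q ^ 14)) := by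
  rcases eq_or_ne q 0 with rfl | hq0
  · simpa [qPochInf₄, qPochInf_zero_right] using hasSum_rogersSelberg_zero 0 0
  have hθ := altTheta_div_qPochInf hq hq0 1 (by norm_num)
  norm_num at hθ
  -- Two of the six factors in the denominator cancel against the triple product.
  have hv : 1 / qPochInf₄ (q ^ 2) (q ^ 4) (q ^ 10) (q ^ 12) (q ^ 14) =
      altTheta q 7 1 / qPochInf (q ^ 2) (q ^ 2) := by
    have h₁ := qPochInf_pow_ne_zero hq (i := 8) (by norm_num)
    have h₂ := qPochInf_pow_ne_zero hq (i := 6) (by norm_num)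
    rw [hθ, qPochInf₄, ← mul_div_mul_left _ _ (mul_ne_zero h₁ h₂), mul_one]
    congr 1
    ring
  rw [hv]
  refine hasSum_rogersSelberg_of_bilat_eq hq hq0 (c := 1) (e := 0) (l := 0)
    (by norm_num) (fun n => ?_) (by norm_num)
  · simpa using bilat_one_self hq0 hq n

/-- The Rogers–Selberg identity with series `∑ p^{2n² + 2n} / ((p²; p²)_n (-p; p)_{2n})`,
multiplied by `(-p; p)_∞`, for `p = q²`. -/
theorem hasSum_rogersSelberg_two :
    HasSum (fun n : ℕ => q ^ (4 * n ^ 2 + 4 * 1 * n) * (qPoch (q ^ 4) (q ^ 4) n)⁻¹ *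
      (qPochInf (-q ^ 2) (q ^ 2) / qPoch (-q ^ 2) (q ^ 2) (2 * n + 0)))
      (1 / qPochInf₄ (q ^ 2) (q ^ 6) (q ^ 8) (q ^ 12) (q ^ 14)) := by
  rcases eq_or_ne q 0 with rfl | hq0
  · simpa [qPochInf₄, qPochInf_zero_right] using hasSum_rogersSelberg_zero 1 0
  have hθ := altTheta_div_qPochInf hq hq0 3 (by norm_num)
  norm_num at hθ
  -- Two of the six factors in the denominator cancel against the triple product.
  have hv : 1 / qPochInf₄ (q ^ 2) (q ^ 6) (q ^ 8) (q ^ 12) (q ^ 14) =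
      altTheta q 7 3 / qPochInf (q ^ 2) (q ^ 2) := by
    have h₁ := qPochInf_pow_ne_zero hq (i := 10) (by norm_num)
    have h₂ := qPochInf_pow_ne_zero hq (i := 4) (by norm_num)
    rw [hθ, qPochInf₄, ← mul_div_mul_left _ _ (mul_ne_zero h₁ h₂), mul_one]
    congr 1
    ring
  rw [hv]
  refine hasSum_rogersSelberg_of_bilat_eq hq hq0 (c := -1) (e := 1) (l := 0)
    (by norm_num) (fun n => ?_) (by norm_num)
  · exact (bilat_neg_one_succ hq0 hq n).trans (bilat_one_self hq0 hq n)

/-- The Rogers–Selberg identity with series `∑ p^{2n² + 2n} / ((p²; p²)_n (-p; p)_{2n+1})`,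
multiplied by `(-p; p)_∞`, for `p = q²`. -/
theorem hasSum_rogersSelberg_three :
    HasSum (fun n : ℕ => q ^ (4 * n ^ 2 + 4 * 1 * n) * (qPoch (q ^ 4) (q ^ 4) n)⁻¹ *
      (qPochInf (-q ^ 2) (q ^ 2) / qPoch (-q ^ 2) (q ^ 2) (2 * n + 1)))
      (1 / qPochInf₄ (q ^ 4) (q ^ 6) (q ^ 8) (q ^ 10) (q ^ 14)) := by
  rcases eq_or_ne q 0 with rfl | hq0
  · simpa [qPochInf₄, qPochInf_zero_right] using hasSum_rogersSelberg_zero 1 1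
  have hθ := altTheta_div_qPochInf hq hq0 5 (by norm_num)
  norm_num at hθ
  -- Two of the six factors in the denominator cancel against the triple product.
  have hv : 1 / qPochInf₄ (q ^ 4) (q ^ 6) (q ^ 8) (q ^ 10) (q ^ 14) =
      altTheta q 7 5 / qPochInf (q ^ 2) (q ^ 2) := by
    have h₁ := qPochInf_pow_ne_zero hq (i := 12) (by norm_num)
    have h₂ := qPochInf_pow_ne_zero hq (i := 2) (by norm_num)
    rw [hθ, qPochInf₄, ← mul_div_mul_left _ _ (mul_ne_zero h₁ h₂), mul_one]
    congr 1
    ring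
  rw [hv]
  refine hasSum_rogersSelberg_of_bilat_eq hq hq0 (c := 1) (e := 1) (l := 1)
    (by norm_num) (fun n => ?_) (by norm_num)
  · rw [qPoch_succ, show 1 - -q ^ 2 * (q ^ 2) ^ (2 * n) = 1 + q ^ (4 * n + 2) by ring, ← mul_assoc,
      ← div_div, ← bilat_one_self hq0 hq]
    exact bilat_one_succ hq0 hq n

end

/-! ### The three double series -/

theorem two_mul_choose_two_succ (m : ℕ) : 2 * ((m + 1).choose 2 : ℤ) = m * (m + 1) := by
  rw [Nat.choose_two_right, Nat.add_sub_cancel]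
  have h2 := Nat.two_mul_div_two_of_even (Nat.even_mul_succ_self m)
  rw [mul_comm (m + 1)]
  exact_mod_cast h2

/-- In terms of `N = m + n` the quadratic part of the exponent is `N² + N`. -/
theorem altTerm_eq (q : ℂ) {c d : ℤ} {k e : ℕ} (hc : c = k - 1) (hd : d = c + e) (m n : ℕ) :
    altTerm c d q m n = q ^ ((m + n) ^ 2 + k * (m + n)) *
      ((qPoch q q m)⁻¹ * ((-q ^ e) ^ n * (qPoch (q ^ 2) (q ^ 2) n)⁻¹)) := by
  have h : 2 * ((m + 1).choose 2 : ℤ) + 2 * ((n + 1).choose 2 : ℤ) + 2 * (m : ℤ) * (n : ℤ) +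
      c * (m : ℤ) + d * (n : ℤ) = (((m + n) ^ 2 + k * (m + n) + e * n : ℕ) : ℤ) := by
    rw [two_mul_choose_two_succ, two_mul_choose_two_succ, hd, hc]
    push_cast
    ring
  rw [altTerm, h, zpow_natCast, pow_add, pow_mul q e, neg_pow (q ^ e), div_eq_mul_inv, mul_inv]
  ring

theorem mainTheorem3 (q : ℂ) (hq : ‖q‖ < 1) :
    HasSum (fun p : ℕ × ℕ => altTerm (-1) (-1) q p.1 p.2)
      (1 / qPochInf₄ (q ^ 2) (q ^ 4) (q ^ 10) (q ^ 12) (q ^ 14)) ∧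
    HasSum (fun p : ℕ × ℕ => altTerm 0 1 q p.1 p.2)
      (1 / qPochInf₄ (q ^ 2) (q ^ 6) (q ^ 8) (q ^ 12) (q ^ 14)) ∧
    HasSum (fun p : ℕ × ℕ => altTerm 1 1 q p.1 p.2)
      (1 / qPochInf₄ (q ^ 4) (q ^ 6) (q ^ 8) (q ^ 10) (q ^ 14)) := by
  refine ⟨?_, ?_, ?_⟩
  · simp only [altTerm_eq q (c := -1) (d := -1) (k := 0) (e := 0) rfl rfl]
    exact hasSum_double_series hq (z := q) (by ring) (by ring) (by simp) hq.le (by ring) (by ring)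
      (hasSum_rogersSelberg_one hq)
  · simp only [altTerm_eq q (c := 0) (d := 1) (k := 1) (e := 1) rfl rfl]
    exact hasSum_double_series hq (z := 1) (by ring) (by ring) (by simpa using hq.le) (by simp)
      (by ring) (by ring) (hasSum_rogersSelberg_two hq)
  · simp only [altTerm_eq q (c := 1) (d := 1) (k := 2) (e := 0) rfl rfl]
    exact hasSum_double_series hq (z := q) (by ring) (by ring) (by simp) hq.le (by ring) (by ring)
      (hasSum_rogersSelberg_three hq)
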